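/- Let $n>1$ and let $a_1,\dots,a_n$ be the annihilation operators of $n$ fermionic sites on the Fock space $\mathcal H\cong\mathbb C^{2^n}$ with vacuum $|0\rangle$, so that $\{a_i^\dagger,a_j\}=\delta_{ij}$ and $\{a_i^\dagger,a_j^\dagger\}=0$. Let $\gamma\in\mathbb C$ with $\gamma^*\gamma=1$ and $\operatorname{Im}\gamma\neq 0$, and let $M$ be the $n\times n$ matrix with $$M_{ij}=\begin{cases}1,& i=j,\\ -i\,\operatorname{Im}\gamma\,(\gamma^*)^{\,j-i-1},& i<j,\\ i\,\operatorname{Im}\gamma\;\gamma^{\,i-j-1},& i>j,\end{cases}$$ (the factor $i$ in front of $\operatorname{Im}\gamma$ being the imaginary unit). Assume that $M$ is invertible, which holds in particular whenever $M$ is positive definite. Let $\eta$ be the unique operator on $\mathcal H$ with $\eta a_i^\dagger=\sum_j M_{ji}a_j^\dagger\eta$ for all $i$ and $\eta|0\rangle=|0\rangle$. An operator $O$ is a quasi-Hermitian observable if $\eta O=O^\dagger\eta$. It is local to $S\subseteq[n]=\{1,\dots,n\}$ (in the sense of Bravyi and Kitaev) if it lies in the span of the products $\prod_{i\in X}a_i^\dagger\prod_{j\in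 Y}a_j$ with $X,Y\subseteq S$ and $|X|+|Y|$ even. It is extensively local over $A$ if it is local to $A$ and not local to any proper subset of $A$. For $A\subseteq[n]$ let $G_A$ be the graph with vertex set $A$ and edges $\{i,i+1\}$ for $i,i+1\in A$. Then, for every $A\subseteq[n]$, there is a quasi-Hermitian observable that is extensively local over $A$ if and only if either $G_A$ has no connected component with exactly one site, or $A=\{1,n\}\cup B$ for some $B\subseteq[n]$ such that $G_B$ has no connected component with exactly one site. -/

import Mathlib

/-- The linear operators on the Fock space of `n` fermionic lattice sites. The Fock space has the
orthonormal basis `|T⟩`, `T` a set of occupied sites, and an operator is given by its matrix in this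
basis, so that the adjoint is the conjugate transpose `ᴴ`. The sites `1, …, n` of the chain are the
elements `0, …, n - 1` of `Fin n`. The vacuum is `|∅⟩`. -/
abbrev FockOp (n : ℕ) : Type := Matrix (Finset (Fin n)) (Finset (Fin n)) ℂ

/-- The sign `(-1) ^ #{j ∈ T | j < i}`. -/
def fermiSign {n : ℕ} (i : Fin n) (T : Finset (Fin n)) : ℂ :=
  (-1) ^ (T.filter (fun j => j < i)).card

/-- The creation operator `a†ᵢ`: it maps `|T⟩` to `± |T ∪ {i}⟩` if `i ∉ T` and to `0` otherwise. -/
def create {n : ℕ} (i : Fin n) : FockOp n :=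
  Matrix.of fun S T => if i ∉ T ∧ S = insert i T then fermiSign i T else 0

/-- The annihilation operator `aᵢ`, the adjoint of `a†ᵢ`. -/
def annihilate {n : ℕ} (i : Fin n) : FockOp n := (create i).conjTranspose

/-- The product of the operators `f i`, `i ∈ S`, with the sites in increasing order. -/
def siteProd {n : ℕ} (f : Fin n → FockOp n) (S : Finset (Fin n)) : FockOp n :=
  (S.sort.map f).prod

/-- The space of operators which are Bravyi-Kitaev local to `S`: the span of the products of an even
number of creation and annihilation operators at sites in `S`. -/
def bkLocal {n : ℕ} (S : Finset (Fin n)) : Submodule ℂ (FockOp n) :=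
  Submodule.span ℂ {O | ∃ A B : Finset (Fin n), A ⊆ S ∧ B ⊆ S ∧ Even (A.card + B.card) ∧
    O = siteProd create A * siteProd annihilate B}

/-- `O` is extensively local over `S`: it is local to `S`, but not to any proper subset of `S`. -/
def IsExtensivelyLocal {n : ℕ} (S : Finset (Fin n)) (O : FockOp n) : Prop :=
  O ∈ bkLocal S ∧ ∀ S₁ : Finset (Fin n), S₁ ⊂ S → O ∉ bkLocal S₁

/-- `O` is a quasi-Hermitian observable with respect to the metric `η`. -/
def IsQuasiHermitian {n : ℕ} (η O : FockOp n) : Prop :=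
  η * O = O.conjTranspose * η

/-- The creation operator `∑ⱼ Mⱼᵢ a†ⱼ` of the `i`-th column of `M`. -/
def createCol {n : ℕ} (M : Matrix (Fin n) (Fin n) ℂ) (i : Fin n) : FockOp n :=
  ∑ j, M j i • create j

/-- The total metric with reduced metric `M`, that is, the unique operator `η` with
`η a†ᵢ = (∑ⱼ Mⱼᵢ a†ⱼ) η` for all `i` and `η |∅⟩ = |∅⟩`. Since `|T⟩` is the increasing product of the
`a†ᵢ`, `i ∈ T`, applied to `|∅⟩`, its column at `T` is the increasing product of the
`∑ⱼ Mⱼᵢ a†ⱼ`, `i ∈ T`, applied to `|∅⟩`. -/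
def totalMetric {n : ℕ} (M : Matrix (Fin n) (Fin n) ℂ) : FockOp n :=
  Matrix.of fun S T => siteProd (createCol M) T S ∅

/-- The reduced metric of the chain with impurities `γ`, `γ*` at its two ends. -/
noncomputable def farReducedMetric (n : ℕ) (γ : ℂ) : Matrix (Fin n) (Fin n) ℂ :=
  Matrix.of fun i j =>
    if i = j then 1
    else if i < j then -Complex.I * (γ.im : ℂ) * (star γ) ^ (j.val - i.val - 1)
    else Complex.I * (γ.im : ℂ) * γ ^ (i.val - j.val - 1)

/-- The graph `G_A`: its vertices are the sites in `A`, and neighbouring sites are adjacent. -/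
def siteGraph {n : ℕ} (A : Finset (Fin n)) : SimpleGraph (A : Set (Fin n)) :=
  (SimpleGraph.pathGraph n).induce (A : Set (Fin n))

/-- No connected component of `G_A` has exactly one site. -/
def NoSingleSiteComponent {n : ℕ} (A : Finset (Fin n)) : Prop :=
  ∀ C : (siteGraph A).ConnectedComponent, C.supp.ncard ≠ 1

/-- The set `{1, n}` of the two ends of the chain. -/
def chainEnds (n : ℕ) : Finset (Fin n) :=
  Finset.univ.filter fun i => i.val = 0 ∨ i.val + 1 = n

/-! The canonical anticommutation relations and the characterization of the total metric. -/

theorem mul_create_apply {n : ℕ} (X : FockOp n) (i : Fin n) (S T : Finset (Fin n)) :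
    (X * create i) S T = if i ∈ T then 0 else fermiSign i T * X S (insert i T) := by
  rw [Matrix.mul_apply]
  by_cases h : i ∈ T
  · simp [create, h]
  · simp [create, h, mul_comm]

theorem create_mul_apply {n : ℕ} (X : FockOp n) (i : Fin n) (S T : Finset (Fin n)) :
    (create i * X) S T = if i ∈ S then fermiSign i (S.erase i) * X (S.erase i) T else 0 := by
  rw [Matrix.mul_apply]
  by_cases h : i ∈ S
  · rw [Finset.sum_eq_single (S.erase i)]
    · simp [create, h]
    · intro U _ hU
      have : ¬ (i ∉ U ∧ S = insert i U) := by
        rintro ⟨h1, rfl⟩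
        exact hU (by simp [h1])
      simp [create, this]
    · simp
  · rw [if_neg h]
    refine Finset.sum_eq_zero fun U _ => ?_
    have : ¬ (i ∉ U ∧ S = insert i U) := by
      rintro ⟨h1, rfl⟩
      exact h (by simp)
    simp [create, this]

theorem fermiSign_insert {n : ℕ} {i j : Fin n} {T : Finset (Fin n)} (hj : j ∉ T) :
    fermiSign i (insert j T) = (if j < i then -1 else 1) * fermiSign i T := by
  unfold fermiSign
  rw [Finset.filter_insert]
  split_ifs with h
  · rw [Finset.card_insert_of_notMem (by simp [hj]), pow_succ]; ring
  · simp

theorem fermiSign_mul_self {n : ℕ} (i : Fin n) (T : Finset (Fin n)) :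
    fermiSign i T * fermiSign i T = 1 := by
  unfold fermiSign
  rw [← mul_pow]; simp

theorem create_anticomm {n : ℕ} (i j : Fin n) :
    create i * create j = -(create j * create i) := by
  ext S T
  rw [Matrix.neg_apply, mul_create_apply, mul_create_apply]
  by_cases hij : i = j
  · subst hij
    by_cases h : i ∈ T <;> simp [create, h]
  · have hji : ¬ j = i := fun h => hij h.symm
    by_cases hi : i ∈ T <;> by_cases hj : j ∈ T <;> simp [create, hi, hj, hij, hji]
    rw [fermiSign_insert hj, fermiSign_insert hi, Finset.insert_comm]
    rcases lt_or_gt_of_ne hij with h | h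
    · simp [h, h.not_gt]; split_ifs <;> ring
    · simp [h, h.not_gt]; split_ifs <;> ring

theorem star_fermiSign {n : ℕ} (i : Fin n) (T : Finset (Fin n)) :
    star (fermiSign i T) = fermiSign i T := by
  simp [fermiSign]

theorem create_annihilate_car {n : ℕ} (i j : Fin n) :
    create i * annihilate j + annihilate j * create i = if i = j then 1 else 0 := by
  ext S T
  rw [Matrix.add_apply, create_mul_apply, mul_create_apply]
  simp only [annihilate, Matrix.conjTranspose_apply, create, Matrix.of_apply, apply_ite star,
    star_zero, star_fermiSign]
  by_cases hij : i = j
  · subst hij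
    by_cases hS : i ∈ S
    · simp only [hS, Finset.notMem_erase, not_false_eq_true, true_and, Finset.insert_erase hS,
        not_true_eq_false, false_and, if_true, if_false, mul_zero, ite_self, add_zero]
      by_cases hT : T = S
      · subst hT
        simp [fermiSign_mul_self]
      · simp [hT, Ne.symm hT]
    · by_cases hST : S = T
      · subst hST
        simp [hS, fermiSign_mul_self]
      · have hne : i ∉ T → insert i T ≠ insert i S := by
          intro hT e
          apply hST
          rw [← Finset.erase_insert hS, ← e, Finset.erase_insert hT]
        by_cases hT : i ∈ T
        · simp [hS, hT, hST]
        · simp [hS, hT, hST, hne hT]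
  · have hji : ¬ j = i := fun h => hij h.symm
    by_cases hc : i ∈ S ∧ j ∉ S ∧ T = insert j (S.erase i)
    · obtain ⟨hi, hj, rfl⟩ := hc
      obtain ⟨R, hR, rfl⟩ : ∃ R, i ∉ R ∧ S = insert i R :=
        ⟨S.erase i, Finset.notMem_erase _ _, (Finset.insert_erase hi).symm⟩
      have hjR : j ∉ R := fun h => hj (Finset.mem_insert_of_mem h)
      rw [Finset.erase_insert hR]
      simp only [Finset.mem_insert_self, Finset.mem_insert, hij, hji, hR, hjR, or_self, if_true,
        not_false_eq_true, true_and, Finset.insert_comm i j, if_false, Matrix.zero_apply,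
        fermiSign_insert hR, fermiSign_insert hjR]
      rcases lt_or_gt_of_ne hij with h | h
      · simp [h, h.not_gt]
      · simp [h, h.not_gt]
    · have h1 : ∀ hi : i ∈ S, ¬ (j ∉ S.erase i ∧ T = insert j (S.erase i)) := by
        rintro hi ⟨hj, hT⟩
        exact hc ⟨hi, fun h => hj (Finset.mem_erase.mpr ⟨hji, h⟩), hT⟩
      have h2 : ∀ hi : i ∉ T, ¬ (j ∉ S ∧ insert i T = insert j S) := by
        rintro hi ⟨hj, hT⟩
        have hiS : i ∈ S := by
          have : i ∈ insert j S := hT ▸ Finset.mem_insert_self i T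
          exact (Finset.mem_insert.mp this).resolve_left hij
        refine hc ⟨hiS, hj, ?_⟩
        rw [← Finset.erase_insert hi, hT, Finset.erase_insert_of_ne hji]
      rw [if_neg hij]
      by_cases hi : i ∈ S <;> by_cases hi' : i ∈ T
      · rw [if_pos hi, if_pos hi', if_neg (h1 hi)]; simp
      · rw [if_pos hi, if_neg hi', if_neg (h1 hi), if_neg (h2 hi')]; simp
      · simp [hi, hi']
      · rw [if_neg hi, if_neg hi', if_neg (h2 hi')]; simp

theorem createCol_anticomm {n : ℕ} (M : Matrix (Fin n) (Fin n) ℂ) (i j : Fin n) :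
    createCol M i * createCol M j = -(createCol M j * createCol M i) := by
  simp only [createCol, Finset.sum_mul, Finset.mul_sum]
  rw [Finset.sum_comm, ← Finset.sum_neg_distrib]
  refine Finset.sum_congr rfl fun x _ => ?_
  rw [← Finset.sum_neg_distrib]
  refine Finset.sum_congr rfl fun y _ => ?_
  rw [smul_mul_smul_comm, smul_mul_smul_comm, create_anticomm, mul_comm, smul_neg]

theorem siteProd_insert_min {n : ℕ} (f : Fin n → FockOp n) {m : Fin n} {T : Finset (Fin n)}
    (h : ∀ x ∈ T, m < x) : siteProd f (insert m T) = f m * siteProd f T := by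
  unfold siteProd
  rw [Finset.sort_insert (· ≤ ·) (fun b hb => (h b hb).le) (fun hm => lt_irrefl _ (h m hm))]
  simp

theorem mul_siteProd {n : ℕ} (f : Fin n → FockOp n) (hf : ∀ i j, f i * f j = -(f j * f i))
    (i : Fin n) (T : Finset (Fin n)) :
    f i * siteProd f T = if i ∈ T then 0 else fermiSign i T • siteProd f (insert i T) := by
  have hsq : ∀ i, f i * f i = 0 := by
    intro i
    ext S T
    have e := congrFun (congrFun (hf i i) S) T
    rw [Matrix.neg_apply] at e
    exact self_eq_neg.mp e
  induction T using Finset.induction_on_min with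
  | empty => simp [siteProd, fermiSign]
  | insert m T h ih =>
    have hm : m ∉ T := fun hm => lt_irrefl _ (h m hm)
    rw [siteProd_insert_min f h, ← mul_assoc]
    rcases lt_trichotomy i m with him | rfl | him
    · have hi : ∀ x ∈ insert m T, i < x := by
        intro x hx
        rcases Finset.mem_insert.mp hx with rfl | hx
        · exact him
        · exact him.trans (h x hx)
      have h1 : i ∉ insert m T := fun hh => lt_irrefl _ (hi i hh)
      have h2 : fermiSign i (insert m T) = 1 := by
        unfold fermiSign
        rw [Finset.filter_eq_empty_iff.mpr (fun x hx => (hi x hx).not_gt)]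
        simp
      rw [if_neg h1, h2, one_smul, siteProd_insert_min f hi, siteProd_insert_min f h, mul_assoc]
    · simp [hsq]
    · rw [hf, neg_mul, mul_assoc, ih]
      by_cases hi : i ∈ T
      · simp [hi]
      · have h1 : i ∉ insert m T := by simp [hi, him.ne']
        have h3 : ∀ x ∈ insert i T, m < x := by
          intro x hx
          rcases Finset.mem_insert.mp hx with rfl | hx
          · exact him
          · exact h x hx
        rw [if_neg hi, if_neg h1, fermiSign_insert hm, if_pos him, Finset.insert_comm,
          siteProd_insert_min f h3, mul_smul_comm]
        simp

/-- The total metric intertwines `a†ᵢ` with `∑ⱼ Mⱼᵢ a†ⱼ`. -/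
theorem totalMetric_mul_create {n : ℕ} (M : Matrix (Fin n) (Fin n) ℂ) (i : Fin n) :
    totalMetric M * create i = createCol M i * totalMetric M := by
  ext S T
  have h := congrFun (congrFun (mul_siteProd _ (createCol_anticomm M) i T) S) ∅
  rw [mul_create_apply]
  have h2 : (createCol M i * totalMetric M) S T = (createCol M i * siteProd (createCol M) T) S ∅ := by
    simp [Matrix.mul_apply, totalMetric]
  rw [h2, h]
  split_ifs <;> simp [totalMetric]

/-- The total metric fixes the vacuum. -/
theorem totalMetric_vacuum {n : ℕ} (M : Matrix (Fin n) (Fin n) ℂ) :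
    (totalMetric M).mulVec (Pi.single ∅ 1) = Pi.single ∅ 1 := by
  ext S
  simp [totalMetric, siteProd, Matrix.one_apply, Pi.single_apply]

/-- The total metric is the only operator with these two properties. -/
theorem totalMetric_unique {n : ℕ} (M : Matrix (Fin n) (Fin n) ℂ) (η : FockOp n)
    (h : ∀ i, η * create i = createCol M i * η)
    (h0 : η.mulVec (Pi.single ∅ 1) = Pi.single ∅ 1) : η = totalMetric M := by
  have key : ∀ T S, η S T = totalMetric M S T := by
    intro T
    induction T using Finset.induction_on_min with
    | empty =>
      intro S
      have e := congrFun (h0.trans (totalMetric_vacuum M).symm) S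
      simpa using e
    | insert m T hm ih =>
      intro S
      have hmT : m ∉ T := fun hh => lt_irrefl _ (hm m hh)
      have e1 := congrFun (congrFun (h m) S) T
      have e2 := congrFun (congrFun (totalMetric_mul_create M m) S) T
      rw [mul_create_apply, if_neg hmT, Matrix.mul_apply] at e1 e2
      simp only [ih] at e1
      rw [← e2] at e1
      have e3 := congrArg (fun z => fermiSign m T * z) e1
      simpa only [← mul_assoc, fermiSign_mul_self, one_mul] using e3
  ext S T
  exact key T S

/-! The reduced metric treats the open chain as a ring. For a site `p` with cyclic successor `q`,
some vector `e_p + x e_q` with `|x| = 1` is sent by `M` to `Re γ (γ e_p + γ* x e_q)`, again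
supported on the bond `{p, q}` (`farReducedMetric_bond`); this includes the bond joining the two
ends. The claim therefore reduces to: an extensively local observable over `A` exists iff every site
of `A` has a cyclic neighbour in `A`.

Necessity: suppose both cyclic neighbours of `i ∈ A` lie outside `A`. Even operators local to `A`
commute with the ladder operators outside `A`, and so do their adjoints. The metric turns the
commutator of `O` with a bond vector into that of `O†` with its image. On the two bonds at `i` only
the `i` components survive, and they give `η [O, a†ᵢ]` as `Re γ γ*` and as `Re γ γ` times `[O†, a†ᵢ]
η`. Since `γ ≠ γ*` and `η` is invertible, both commutators vanish (`commute_of_neighbours_notMem`).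
Then `O` is already local to `A` without `i` (`mem_bkLocal_erase_of_commute`).

Sufficiency: each bond carries a quadratic quasi-Hermitian observable, and the sum over the bonds
inside `A` acts nontrivially at every site of `A` (`exists_extensivelyLocal`). Invertibility of `M`
enters here through `Re γ ≠ 0`. -/

/-! ### Even local operators commute with ladder operators at other sites -/

theorem annihilate_anticomm {n : ℕ} (i j : Fin n) :
    annihilate i * annihilate j = -(annihilate j * annihilate i) := by
  rw [annihilate, annihilate, ← Matrix.conjTranspose_mul, create_anticomm,
    Matrix.conjTranspose_neg, Matrix.conjTranspose_mul]

theorem mul_siteProd_of_anticomm {n : ℕ} (f : Fin n → FockOp n) (x : FockOp n)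
    (T : Finset (Fin n)) (h : ∀ j ∈ T, x * f j = -(f j * x)) :
    x * siteProd f T = (-1 : ℂ) ^ T.card • (siteProd f T * x) := by
  have key : ∀ l : List (Fin n), (∀ j ∈ l, x * f j = -(f j * x)) →
      x * (l.map f).prod = (-1 : ℂ) ^ l.length • ((l.map f).prod * x) := by
    intro l
    induction l with
    | nil => simp
    | cons a l ih =>
      intro hl
      rw [List.map_cons, List.prod_cons, ← mul_assoc, hl a (by simp), neg_mul, mul_assoc,
        ih (fun j hj => hl j (by simp [hj])), mul_smul_comm, List.length_cons, pow_succ, mul_assoc]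
      simp
  have := key T.sort (fun j hj => h j (by simpa using hj))
  simpa [siteProd] using this

/-- Each factor of a monomial contributes one sign when `x` is moved through it, and the even number
of factors cancels the signs. -/
theorem commute_of_anticomm {n : ℕ} (x : FockOp n) (S : Finset (Fin n))
    (hc : ∀ j ∈ S, x * create j = -(create j * x))
    (ha : ∀ j ∈ S, x * annihilate j = -(annihilate j * x))
    {O : FockOp n} (hO : O ∈ bkLocal S) : O * x = x * O := by
  induction hO using Submodule.span_induction with
  | mem O h =>
    obtain ⟨A, B, hA, hB, hE, rfl⟩ := h
    rw [← mul_assoc, mul_siteProd_of_anticomm create x A (fun j hj => hc j (hA hj)),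
      smul_mul_assoc, mul_assoc (siteProd create A) x,
      mul_siteProd_of_anticomm annihilate x B (fun j hj => ha j (hB hj)), mul_smul_comm, smul_smul,
      ← pow_add, hE.neg_one_pow, one_smul, mul_assoc]
  | zero => simp
  | add O P _ _ h1 h2 => rw [add_mul, mul_add, h1, h2]
  | smul c O _ h => rw [smul_mul_assoc, mul_smul_comm, h]

theorem create_annihilate_anticomm {n : ℕ} {i j : Fin n} (h : i ≠ j) :
    create i * annihilate j = -(annihilate j * create i) := by
  have := create_annihilate_car i j
  rw [if_neg h] at this
  exact eq_neg_of_add_eq_zero_left this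

theorem annihilate_create_anticomm {n : ℕ} {i j : Fin n} (h : i ≠ j) :
    annihilate i * create j = -(create j * annihilate i) := by
  rw [create_annihilate_anticomm h.symm, neg_neg]

theorem commute_create_of_mem_bkLocal {n : ℕ} {i : Fin n} {S : Finset (Fin n)} (hi : i ∉ S)
    {O : FockOp n} (hO : O ∈ bkLocal S) : O * create i = create i * O :=
  commute_of_anticomm _ S (fun j _ => create_anticomm i j)
    (fun _ hj => create_annihilate_anticomm fun e => hi (e ▸ hj)) hO

theorem commute_annihilate_of_mem_bkLocal {n : ℕ} {i : Fin n} {S : Finset (Fin n)} (hi : i ∉ S)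
    {O : FockOp n} (hO : O ∈ bkLocal S) : O * annihilate i = annihilate i * O :=
  commute_of_anticomm _ S
    (fun j hj => annihilate_create_anticomm (show i ≠ j from fun e => hi (e ▸ hj)))
    (fun j _ => annihilate_anticomm i j) hO

/-! ### Removing a site from the support -/

theorem annihilate_mul_self {n : ℕ} (i : Fin n) : annihilate i * annihilate i = (0 : FockOp n) := by
  have h := mul_siteProd annihilate annihilate_anticomm i {i}
  simpa [siteProd] using h

/-- The compression `O ↦ aᵢ a†ᵢ O aᵢ a†ᵢ + a†ᵢ O aᵢ`. It fixes the operators which commute with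
`aᵢ` and `a†ᵢ`, and kills the normally ordered monomials which contain `aᵢ` or `a†ᵢ`. -/
def siteCompress {n : ℕ} (i : Fin n) (O : FockOp n) : FockOp n :=
  annihilate i * create i * O * (annihilate i * create i) + create i * O * annihilate i

/-- Once `O` is pulled to the right, what remains is the projection `aᵢ a†ᵢ` plus `a†ᵢ aᵢ`, which is
`1`. -/
theorem siteCompress_of_commute {n : ℕ} {i : Fin n} {O : FockOp n}
    (hc : O * create i = create i * O) (ha : O * annihilate i = annihilate i * O) :
    siteCompress i O = O := by
  have h := create_annihilate_car i i
  rw [if_pos rfl] at h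
  have hp : annihilate i * create i * (annihilate i * create i) = (annihilate i * create i : FockOp n) := by
    have : annihilate i * create i = (1 - create i * annihilate i : FockOp n) := by rw [← h]; abel
    rw [this]
    have e : create i * annihilate i * (create i * annihilate i) = (create i * annihilate i : FockOp n) := by
      rw [mul_assoc, ← mul_assoc (annihilate i), this, sub_mul, one_mul, mul_sub,
        mul_assoc (create i) (annihilate i) (annihilate i), annihilate_mul_self]
      simp
    rw [sub_mul, mul_sub, mul_sub, e]
    simp
  rw [siteCompress, mul_assoc (annihilate i * create i) O, ← mul_assoc O, ha, mul_assoc (annihilate i) O,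
    hc, ← mul_assoc (annihilate i) (create i) O, ← mul_assoc, hp, mul_assoc (create i), ha, ← mul_assoc,
    ← add_mul, add_comm, h, one_mul]

theorem siteCompress_mem {n : ℕ} (i : Fin n) {S : Finset (Fin n)} {O : FockOp n}
    (hO : O ∈ bkLocal S) : siteCompress i O ∈ bkLocal (S.erase i) := by
  induction hO using Submodule.span_induction with
  | mem O h =>
    obtain ⟨A, B, hA, hB, hE, rfl⟩ := h
    by_cases hiA : i ∈ A
    · have h0 : create i * siteProd create A = 0 := by
        rw [mul_siteProd create create_anticomm, if_pos hiA]
      have : siteCompress i (siteProd create A * siteProd annihilate B) = 0 := by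
        rw [siteCompress, mul_assoc (annihilate i), ← mul_assoc (create i), h0]
        simp
      rw [this]
      exact Submodule.zero_mem _
    by_cases hiB : i ∈ B
    · have h0 : siteProd annihilate B * annihilate i = 0 := by
        have h1 := mul_siteProd_of_anticomm annihilate (annihilate i) B
          (fun j _ => annihilate_anticomm i j)
        rw [mul_siteProd annihilate annihilate_anticomm, if_pos hiB] at h1
        exact (smul_eq_zero.mp h1.symm).resolve_left (by simp)
      have : siteCompress i (siteProd create A * siteProd annihilate B) = 0 := by
        have h1 : siteProd create A * siteProd annihilate B * annihilate i = 0 := by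
          rw [mul_assoc, h0, mul_zero]
        rw [siteCompress, mul_assoc (annihilate i * create i), ← mul_assoc _ (annihilate i), h1,
          mul_assoc (create i), h1]
        simp
      rw [this]
      exact Submodule.zero_mem _
    have hm : siteProd create A * siteProd annihilate B ∈ bkLocal (S.erase i) :=
      Submodule.subset_span ⟨A, B, fun x hx => Finset.mem_erase.mpr ⟨fun e => hiA (e ▸ hx), hA hx⟩,
        fun x hx => Finset.mem_erase.mpr ⟨fun e => hiB (e ▸ hx), hB hx⟩, hE, rfl⟩
    rwa [siteCompress_of_commute (commute_create_of_mem_bkLocal (Finset.notMem_erase i S) hm)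
      (commute_annihilate_of_mem_bkLocal (Finset.notMem_erase i S) hm)]
  | zero => simp [siteCompress]
  | add O P _ _ h1 h2 =>
    have : siteCompress i (O + P) = siteCompress i O + siteCompress i P := by
      simp only [siteCompress, mul_add, add_mul]; abel
    rw [this]
    exact Submodule.add_mem _ h1 h2
  | smul c O _ h =>
    have : siteCompress i (c • O) = c • siteCompress i O := by
      simp only [siteCompress, mul_smul_comm, smul_mul_assoc, smul_add]
    rw [this]
    exact Submodule.smul_mem _ _ h

/-- Converse of the commutation lemmas: compression fixes `O` and at the same time removes every
monomial involving `i`. -/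
theorem mem_bkLocal_erase_of_commute {n : ℕ} {i : Fin n} {S : Finset (Fin n)} {O : FockOp n}
    (hO : O ∈ bkLocal S) (hc : O * create i = create i * O)
    (ha : O * annihilate i = annihilate i * O) : O ∈ bkLocal (S.erase i) := by
  rw [← siteCompress_of_commute hc ha]
  exact siteCompress_mem i hO

/-! ### Multiplicativity and invertibility of the total metric -/

theorem createCol_one {n : ℕ} (i : Fin n) : createCol 1 i = create i := by
  simp [createCol, Matrix.one_apply]

theorem totalMetric_one {n : ℕ} : totalMetric (1 : Matrix (Fin n) (Fin n) ℂ) = 1 :=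
  (totalMetric_unique 1 1 (fun i => by rw [createCol_one, one_mul, mul_one]) (Matrix.one_mulVec _)).symm

theorem totalMetric_mul {n : ℕ} (M N : Matrix (Fin n) (Fin n) ℂ) :
    totalMetric M * totalMetric N = totalMetric (M * N) := by
  refine totalMetric_unique _ _ (fun i => ?_) ?_
  · have h : totalMetric M * createCol N i = createCol (M * N) i * totalMetric M := by
      simp only [createCol, Finset.mul_sum, Finset.sum_mul, mul_smul_comm, smul_mul_assoc,
        totalMetric_mul_create, Finset.smul_sum, smul_smul, Matrix.mul_apply, Finset.sum_smul]
      rw [Finset.sum_comm]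
      simp only [mul_comm]
    rw [mul_assoc, totalMetric_mul_create, ← mul_assoc, h, mul_assoc]
  · rw [← Matrix.mulVec_mulVec, totalMetric_vacuum, totalMetric_vacuum]

theorem isUnit_totalMetric {n : ℕ} {M : Matrix (Fin n) (Fin n) ℂ} (hM : M.det ≠ 0) :
    IsUnit (totalMetric M) := by
  refine IsUnit.of_mul_eq_one (totalMetric M⁻¹) ?_
  rw [totalMetric_mul, Matrix.mul_nonsing_inv _ (isUnit_iff_ne_zero.mpr hM), totalMetric_one]

/-- Here `M` need not be Hermitian, so taking adjoints of the creation relation does not suffice.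
Instead the difference `D` of the two sides kills the vacuum and satisfies `D a†ᵢ = -(∑ⱼ Mⱼᵢ a†ⱼ)
D`, so it kills every state built from the vacuum. -/
theorem annihilate_mul_totalMetric {n : ℕ} (M : Matrix (Fin n) (Fin n) ℂ) (l : Fin n) :
    annihilate l * totalMetric M = totalMetric M * ∑ j, M l j • annihilate j := by
  set D := annihilate l * totalMetric M - totalMetric M * ∑ j, M l j • annihilate j with hD
  have hann : ∀ (j : Fin n), (annihilate j).mulVec (Pi.single ∅ 1) = 0 := by
    intro j
    ext S
    simp [annihilate, create, (Finset.insert_ne_empty j S).symm]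
  have h0 : D.mulVec (Pi.single ∅ 1) = 0 := by
    rw [hD, Matrix.sub_mulVec, ← Matrix.mulVec_mulVec, totalMetric_vacuum, hann,
      ← Matrix.mulVec_mulVec, Matrix.sum_mulVec]
    simp only [Matrix.smul_mulVec, hann]
    simp
  have hac : ∀ i j : Fin n, annihilate i * create j = (if i = j then 1 else 0) - create j * annihilate i := by
    intro i j
    rw [eq_sub_iff_add_eq, add_comm, create_annihilate_car]
    simp only [eq_comm]
  have hstep : ∀ i, D * create i = -(createCol M i * D) := by
    intro i
    have h1 : annihilate l * createCol M i = M l i • 1 - createCol M i * annihilate l := by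
      simp only [createCol, Finset.mul_sum, mul_smul_comm, hac, smul_sub, Finset.sum_sub_distrib,
        Finset.sum_mul, smul_mul_assoc]
      simp
    have h2 : (∑ j, M l j • annihilate j) * create i =
        M l i • 1 - create i * ∑ j, M l j • annihilate j := by
      simp only [Finset.mul_sum, mul_smul_comm, smul_mul_assoc, hac, smul_sub,
        Finset.sum_sub_distrib, Finset.sum_mul]
      simp
    rw [hD, sub_mul, mul_assoc, totalMetric_mul_create, ← mul_assoc, h1, mul_assoc, h2, mul_sub,
      ← mul_assoc (totalMetric M) (create i), totalMetric_mul_create, mul_sub, sub_mul]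
    simp only [smul_mul_assoc, mul_smul_comm, one_mul, mul_one, mul_assoc]
    abel
  have key : ∀ T S, D S T = 0 := by
    intro T
    induction T using Finset.induction_on_min with
    | empty =>
      intro S
      simpa using congrFun h0 S
    | insert m T hm ih =>
      intro S
      have hmT : m ∉ T := fun hh => lt_irrefl _ (hm m hh)
      have e := congrFun (congrFun (hstep m) S) T
      rw [mul_create_apply, if_neg hmT, Matrix.neg_apply, Matrix.mul_apply] at e
      simp only [ih, mul_zero, Finset.sum_const_zero, neg_zero] at e
      exact (mul_eq_zero.mp e).resolve_left fun h => by
        simpa [h] using fermiSign_mul_self m T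
  refine sub_eq_zero.mp ?_
  rw [← hD]
  ext S T
  exact key T S

/-! ### Bond vectors of the reduced metric -/

theorem finRotate_val {n : ℕ} (p : Fin n) :
    (finRotate n p).val = if p.val + 1 = n then 0 else p.val + 1 := by
  cases n with
  | zero => exact p.elim0
  | succ m =>
    rw [coe_finRotate]
    simp [Fin.ext_iff]

/-- The coefficient `x` for which `M (e_p + x e_q)` is supported on `{p, q}`, where `q` is the cyclic
successor of the site `p` and `M` is the reduced metric of the chain. -/
noncomputable def bondCoeff {n : ℕ} (γ : ℂ) (p : Fin n) : ℂ :=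
  if p.val + 1 = n then γ * star γ ^ (n - 2) else -γ

theorem bondCoeff_star_mul {n : ℕ} {γ : ℂ} (hγ : star γ * γ = 1) (p : Fin n) :
    star (bondCoeff γ p) * bondCoeff γ p = 1 := by
  unfold bondCoeff
  split_ifs
  · rw [star_mul', star_pow, star_star]
    calc star γ * γ ^ (n - 2) * (γ * star γ ^ (n - 2))
        = (star γ * γ) * (star γ * γ) ^ (n - 2) := by rw [mul_pow]; ring
      _ = 1 := by rw [hγ]; simp
  · simpa using hγ

theorem re_add_I_mul_im (γ : ℂ) : γ = γ.re + Complex.I * γ.im := by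
  rw [mul_comm]; exact (Complex.re_add_im γ).symm

theorem star_eq_re_sub (γ : ℂ) : star γ = γ.re - Complex.I * γ.im := by
  apply Complex.ext <;> simp

/-- Away from `p` and `q` the two columns are proportional: their entries are powers of `γ` or `γ*`
shifted by one site, or, on the bond joining the ends, powers running in opposite directions that
`γ* γ = 1` makes proportional. The coefficient `x` cancels them. On the bond itself, `γ ∓ i Im γ`
and its conjugate produce `Re γ`. -/
theorem farReducedMetric_bond {n : ℕ} (hn : 1 < n) {γ : ℂ} (hγ : star γ * γ = 1) (p k : Fin n) :
    farReducedMetric n γ k p + bondCoeff γ p * farReducedMetric n γ k (finRotate n p) =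
      γ.re * (γ * (if p = k then 1 else 0) +
        star γ * bondCoeff γ p * (if finRotate n p = k then 1 else 0)) := by
  have hg : (γ.re : ℂ) = γ - Complex.I * γ.im := by linear_combination -(re_add_I_mul_im γ)
  have hg' : (γ.re : ℂ) = star γ + Complex.I * γ.im := by linear_combination -(star_eq_re_sub γ)
  have hv := finRotate_val p
  set q := finRotate n p with hq
  have hpn := p.isLt
  have hkn := k.isLt
  simp only [farReducedMetric, Matrix.of_apply, Fin.lt_def, Fin.ext_iff, bondCoeff]
  by_cases hp : p.val + 1 = n
  · rw [if_pos hp] at hv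
    simp only [if_pos hp, hv]
    rcases Nat.eq_zero_or_pos k.val with h0 | h0
    · have e1 : ¬ (k.val = p.val) := by omega
      have e2 : k.val < p.val := by omega
      have e3 : p.val - k.val - 1 = n - 2 := by omega
      simp only [if_neg e1, if_neg (Ne.symm e1), if_pos e2, if_pos h0, if_pos h0.symm, e3]
      linear_combination (-(star γ ^ (n-2)) * γ.re) * hγ - star γ ^ (n-2) * hg
    · by_cases h1 : k.val = p.val
      · have e1 : ¬ (k.val = 0) := by omega
        have e2 : ¬ (0 = k.val) := by omega
        have e4 : k.val - 0 - 1 = n - 2 := by omega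
        have e5 : star γ ^ (n - 2) * γ ^ (n - 2) = 1 := by rw [← mul_pow, hγ, one_pow]
        simp only [if_pos h1, if_pos h1.symm, if_neg e1, if_neg e2, if_neg (Nat.not_lt_zero _), e4]
        linear_combination γ * Complex.I * γ.im * e5 - hγ - γ * hg'
      -- An interior site seen from the closing bond: its distances to the two ends are `a + 1` and
      -- `b + 1`, which removes the truncated subtractions.
      · obtain ⟨a, ha⟩ : ∃ a, k.val = a + 1 := ⟨k.val - 1, by omega⟩
        obtain ⟨b, hb⟩ : ∃ b, p.val = k.val + (b + 1) := ⟨p.val - k.val - 1, by omega⟩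
        have e1 : ¬ (k.val = 0) := by omega
        have e2 : ¬ (0 = k.val) := by omega
        have e3 : p.val - k.val - 1 = b := by omega
        have e4 : k.val - 0 - 1 = a := by omega
        have e6 : n - 2 = a + b + 1 := by omega
        have e7 : k.val < p.val := by omega
        have e5 : star γ ^ a * γ ^ a = 1 := by rw [← mul_pow, hγ, one_pow]
        simp only [if_neg h1, if_neg (Ne.symm h1), if_neg e1, if_neg e2,
          if_neg (Nat.not_lt_zero _), if_pos e7, e3, e4, e6]
        linear_combination Complex.I * γ.im * star γ ^ b * (star γ * γ * e5 + hγ)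
  · rw [if_neg hp] at hv
    simp only [if_neg hp, hv]
    rcases lt_trichotomy k.val p.val with h | h | h
    · obtain ⟨b, hb⟩ : ∃ b, p.val = k.val + (b + 1) := ⟨p.val - k.val - 1, by omega⟩
      have e1 : ¬ (k.val = p.val) := by omega
      have e2 : ¬ (k.val = p.val + 1) := by omega
      have e3 : p.val - k.val - 1 = b := by omega
      have e4 : p.val + 1 - k.val - 1 = b + 1 := by omega
      have e5 : k.val < p.val + 1 := by omega
      simp only [if_neg e1, if_neg (Ne.symm e1), if_neg e2, if_neg (Ne.symm e2), if_pos h,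
        if_pos e5, e3, e4]
      linear_combination Complex.I * γ.im * star γ ^ b * hγ
    · have e2 : ¬ (k.val = p.val + 1) := by omega
      have e4 : p.val + 1 - k.val - 1 = 0 := by omega
      have e5 : k.val < p.val + 1 := by omega
      simp only [if_pos h, if_pos h.symm, if_neg e2, if_neg (Ne.symm e2), if_pos e5, e4]
      linear_combination -hγ - γ * hg'
    · have e1 : ¬ (k.val = p.val) := by omega
      have e6 : ¬ (k.val < p.val) := by omega
      have e7 : ¬ (k.val < p.val + 1) := by omega
      by_cases e2 : k.val = p.val + 1
      · have e4 : k.val - p.val - 1 = 0 := by omega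
        simp only [if_neg e1, if_neg (Ne.symm e1), if_pos e2, if_pos e2.symm, if_neg e6, e4]
        linear_combination γ.re * hγ + hg
      · obtain ⟨b, hb⟩ : ∃ b, k.val = p.val + (b + 2) := ⟨k.val - p.val - 2, by omega⟩
        have e3 : k.val - p.val - 1 = b + 1 := by omega
        have e4 : k.val - (p.val + 1) - 1 = b := by omega
        simp only [if_neg e1, if_neg (Ne.symm e1), if_neg e2, if_neg (Ne.symm e2), if_neg e6,
          if_neg e7, e3, e4]
        ring

theorem farReducedMetric_star {n : ℕ} (γ : ℂ) (i j : Fin n) :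
    star (farReducedMetric n γ i j) = farReducedMetric n γ j i := by
  simp only [farReducedMetric, Matrix.of_apply]
  rcases lt_trichotomy i j with h | h | h
  · simp [h.ne, h.ne', h, h.not_gt]
  · simp [h]
  · simp [h.ne, h.ne', h, h.not_gt]

theorem finRotate_ne {n : ℕ} (hn : 1 < n) (p : Fin n) : finRotate n p ≠ p := by
  intro h
  have := finRotate_val p
  rw [h] at this
  split_ifs at this <;> omega

/-- If `Re γ = 0`, the bond vector is a nonzero element of the kernel of `M`. -/
theorem re_ne_zero_of_det_ne_zero {n : ℕ} (hn : 1 < n) {γ : ℂ} (hγ : star γ * γ = 1)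
    (hM : (farReducedMetric n γ).det ≠ 0) : γ.re ≠ 0 := by
  intro h0
  let p : Fin n := ⟨0, by omega⟩
  have hv : (farReducedMetric n γ).mulVec
      (Pi.single p 1 + bondCoeff γ p • Pi.single (finRotate n p) 1) = 0 := by
    ext k
    have := farReducedMetric_bond hn hγ p k
    rw [h0] at this
    simpa [Matrix.mulVec_add, Matrix.mulVec_smul] using this
  have hne := (finRotate_ne hn p).symm
  have h1 := congrFun (Matrix.eq_zero_of_mulVec_eq_zero hM hv) p
  generalize finRotate n p = q at h1 hne
  simp [hne] at h1

theorem totalMetric_bond {n : ℕ} (hn : 1 < n) {γ : ℂ} (hγ : star γ * γ = 1) (p : Fin n) :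
    totalMetric (farReducedMetric n γ) *
        (create p + bondCoeff γ p • create (finRotate n p)) =
      (γ.re : ℂ) • (γ • create p + (star γ * bondCoeff γ p) • create (finRotate n p)) *
        totalMetric (farReducedMetric n γ) := by
  rw [mul_add, mul_smul_comm, totalMetric_mul_create, totalMetric_mul_create, ← smul_mul_assoc,
    ← add_mul]
  congr 1
  simp only [createCol, Finset.smul_sum, smul_smul, ← Finset.sum_add_distrib, ← add_smul,
    farReducedMetric_bond hn hγ p]
  simp only [mul_add, add_smul, Finset.sum_add_distrib, smul_add, smul_smul]
  simp

/-- Since `M` is Hermitian, conjugating the column identity for the bond gives the row identity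
needed here. -/
theorem bond_mul_totalMetric {n : ℕ} (hn : 1 < n) {γ : ℂ} (hγ : star γ * γ = 1) (p : Fin n) :
    (annihilate p + star (bondCoeff γ p) • annihilate (finRotate n p)) *
        totalMetric (farReducedMetric n γ) =
      totalMetric (farReducedMetric n γ) * ((γ.re : ℂ) • (star γ • annihilate p +
        (γ * star (bondCoeff γ p)) • annihilate (finRotate n p))) := by
  rw [add_mul, smul_mul_assoc, annihilate_mul_totalMetric, annihilate_mul_totalMetric,
    ← mul_smul_comm, ← mul_add]
  congr 1
  have h : ∀ k, farReducedMetric n γ p k +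
      star (bondCoeff γ p) * farReducedMetric n γ (finRotate n p) k =
      γ.re * (star γ * (if p = k then 1 else 0) +
        γ * star (bondCoeff γ p) * (if finRotate n p = k then 1 else 0)) := by
    intro k
    have := congrArg star (farReducedMetric_bond hn hγ p k)
    simpa [farReducedMetric_star, apply_ite star] using this
  simp only [Finset.smul_sum, smul_smul, ← Finset.sum_add_distrib, ← add_smul, h]
  simp only [mul_add, add_smul, Finset.sum_add_distrib, smul_add, smul_smul]
  simp

/-! ### Necessity: a site whose cyclic neighbours are both absent drops out -/

theorem commute_of_neighbours_notMem {n : ℕ} (hn : 1 < n) {γ : ℂ} (hγ : star γ * γ = 1)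
    (hγ_im : γ.im ≠ 0) (hM : (farReducedMetric n γ).det ≠ 0) {A : Finset (Fin n)} {O : FockOp n}
    (hQ : IsQuasiHermitian (totalMetric (farReducedMetric n γ)) O) (hO : O ∈ bkLocal A) {p : Fin n}
    (hp : p ∉ A) (hq : finRotate n (finRotate n p) ∉ A) :
    O * create (finRotate n p) = create (finRotate n p) * O ∧
      O * annihilate (finRotate n p) = annihilate (finRotate n p) * O := by
  have hre := re_ne_zero_of_det_ne_zero hn hγ hM
  have hU := isUnit_totalMetric hM
  have b1 := totalMetric_bond hn hγ p
  have b2 := totalMetric_bond hn hγ (finRotate n p)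
  unfold IsQuasiHermitian at hQ
  set η := totalMetric (farReducedMetric n γ)
  have hx : bondCoeff γ p ≠ 0 := fun h => by
    simpa [h] using bondCoeff_star_mul hγ p
  set i := finRotate n p
  set q := finRotate n i
  set X := O.conjTranspose with hX
  -- The relation for `X = O†` is the adjoint of the commutation of `O` with `aₖ`.
  have comm : ∀ k ∉ A, O * create k = create k * O ∧ X * create k = create k * X := by
    intro k hk
    refine ⟨commute_create_of_mem_bkLocal hk hO, ?_⟩
    have := congrArg Matrix.conjTranspose (commute_annihilate_of_mem_bkLocal hk hO)
    rw [Matrix.conjTranspose_mul, Matrix.conjTranspose_mul, annihilate,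
      Matrix.conjTranspose_conjTranspose] at this
    exact this.symm
  -- Quasi-Hermiticity transports commutators: `η [O, w] = [O†, w'] η` whenever `η w = w' η`.
  have tr : ∀ w w' : FockOp n, η * w = w' * η → η * (O * w - w * O) = (X * w' - w' * X) * η := by
    intro w w' h
    rw [mul_sub, sub_mul, ← mul_assoc, hQ, mul_assoc, h, ← mul_assoc η, h, mul_assoc w' η, hQ]
    simp only [mul_assoc]
  have t1 := tr _ _ b1
  have t2 := tr _ _ b2
  obtain ⟨hp1, hp2⟩ := comm p hp
  obtain ⟨hq1, hq2⟩ := comm q hq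
  set E := O * create i - create i * O with hE
  set F := X * create i - create i * X with hF
  -- On the bond from `p` to `i`, the site `i` is the second one, so its image has the weight `γ*`;
  -- the common factor `x` cancels.
  have r1 : η * E = ((γ.re : ℂ) * star γ) • (F * η) := by
    have e1 : O * (create p + bondCoeff γ p • create i) - (create p + bondCoeff γ p • create i) * O =
        bondCoeff γ p • E := by
      rw [mul_add, add_mul, hp1, hE, smul_sub, mul_smul_comm, smul_mul_assoc]; abel
    have e2 : X * ((γ.re : ℂ) • (γ • create p + (star γ * bondCoeff γ p) • create i)) -
        ((γ.re : ℂ) • (γ • create p + (star γ * bondCoeff γ p) • create i)) * X =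
        bondCoeff γ p • ((γ.re : ℂ) * star γ) • F := by
      simp only [mul_smul_comm, smul_mul_assoc, mul_add, add_mul, hp2, hF]
      module
    rw [e1, e2, mul_smul_comm, smul_mul_assoc] at t1
    rw [← smul_mul_assoc]
    exact smul_right_injective _ hx t1
  -- On the bond from `i` to `q`, the site `i` is the first one, so its image has the weight `γ`.
  have r2 : η * E = ((γ.re : ℂ) * γ) • (F * η) := by
    have e1 : O * (create i + bondCoeff γ i • create q) - (create i + bondCoeff γ i • create q) * O =
        E := by
      rw [mul_add, add_mul, mul_smul_comm, smul_mul_assoc, hq1, hE]; abel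
    have e2 : X * ((γ.re : ℂ) • (γ • create i + (star γ * bondCoeff γ i) • create q)) -
        ((γ.re : ℂ) • (γ • create i + (star γ * bondCoeff γ i) • create q)) * X =
        ((γ.re : ℂ) * γ) • F := by
      simp only [mul_smul_comm, smul_mul_assoc, mul_add, add_mul, hq2, hF]
      module
    rw [e1, e2] at t2
    rw [← smul_mul_assoc]
    exact t2
  -- Subtracting the two relations leaves the scalar `Re γ (γ - γ*) = 2 i Re γ Im γ`, which is
  -- nonzero.
  have hFη : F * η = 0 := by
    have h := r2.symm.trans r1
    rw [← sub_eq_zero, ← sub_smul, ← mul_sub] at h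
    refine (smul_eq_zero.mp h).resolve_left (mul_ne_zero (by exact_mod_cast hre) fun h0 => hγ_im ?_)
    have := congrArg Complex.im h0
    simp at this
    linarith
  have hF0 : F = 0 := by
    refine hU.mul_right_cancel ?_
    rw [hFη, zero_mul]
  have hE0 : E = 0 := by
    refine hU.mul_left_cancel ?_
    rw [r1, hFη, smul_zero, mul_zero]
  refine ⟨sub_eq_zero.mp hE0, ?_⟩
  have := congrArg Matrix.conjTranspose (sub_eq_zero.mp hF0)
  rw [Matrix.conjTranspose_mul, Matrix.conjTranspose_mul, hX,
    Matrix.conjTranspose_conjTranspose] at this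
  exact this.symm

/-! ### Sufficiency: observables on bonds -/

/-- The quasi-Hermitian observable supported on the bond of the site `p` and its cyclic successor. -/
noncomputable def bondObs {n : ℕ} (γ : ℂ) (p : Fin n) : FockOp n :=
  (create p + bondCoeff γ p • create (finRotate n p)) *
    ((γ.re : ℂ) • (star γ • annihilate p +
      (γ * star (bondCoeff γ p)) • annihilate (finRotate n p)))

/-- Write the observable as `w v`, where `η w = v† η` and `w† η = η v`. Then `η w v = v† η v = v† w†
η`. -/
theorem isQuasiHermitian_bondObs {n : ℕ} (hn : 1 < n) {γ : ℂ} (hγ : star γ * γ = 1) (p : Fin n) :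
    IsQuasiHermitian (totalMetric (farReducedMetric n γ)) (bondObs γ p) := by
  have h : (bondObs γ p).conjTranspose =
      ((γ.re : ℂ) • (γ • create p + (star γ * bondCoeff γ p) • create (finRotate n p))) *
        (annihilate p + star (bondCoeff γ p) • annihilate (finRotate n p)) := by
    simp [bondObs, annihilate, Matrix.conjTranspose_mul, Matrix.conjTranspose_add,
      Matrix.conjTranspose_smul, Matrix.conjTranspose_conjTranspose]
  rw [IsQuasiHermitian, h, mul_assoc, bond_mul_totalMetric hn hγ, bondObs, ← mul_assoc,
    totalMetric_bond hn hγ, mul_assoc]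

theorem create_mul_annihilate_mem_bkLocal {n : ℕ} {A : Finset (Fin n)} {i j : Fin n} (hi : i ∈ A)
    (hj : j ∈ A) : create i * annihilate j ∈ bkLocal A :=
  Submodule.subset_span ⟨{i}, {j}, by simpa using hi, by simpa using hj, by simp,
    by simp [siteProd]⟩

theorem bondObs_mem_bkLocal {n : ℕ} (γ : ℂ) {A : Finset (Fin n)} {p : Fin n} (hp : p ∈ A)
    (hq : finRotate n p ∈ A) : bondObs γ p ∈ bkLocal A := by
  simp only [bondObs, mul_add, add_mul, mul_smul_comm, smul_mul_assoc, smul_add]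
  refine Submodule.add_mem _ (Submodule.add_mem _ ?_ ?_) (Submodule.add_mem _ ?_ ?_) <;>
  repeat' apply Submodule.smul_mem
  all_goals exact create_mul_annihilate_mem_bkLocal ‹_› ‹_›

theorem bondObs_vacuum {n : ℕ} (γ : ℂ) (p : Fin n) : bondObs γ p ∅ ∅ = 0 := by
  simp [bondObs, add_mul, create_mul_apply]

/-- Diagonal one-particle entries, to be compared with the vacuum entry `0`: a difference between
them shows that the site `i` is needed in the support. -/
theorem bondObs_singleton {n : ℕ} (hn : 1 < n) {γ : ℂ} (hγ : star γ * γ = 1) (p i : Fin n) :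
    bondObs γ p {i} {i} =
      γ.re * ((if p = i then star γ else 0) + (if finRotate n p = i then γ else 0)) := by
  have hne := finRotate_ne hn p
  have hx := bondCoeff_star_mul hγ p
  unfold bondObs
  generalize finRotate n p = q at *
  generalize bondCoeff γ p = x at *
  have hann : ∀ j : Fin n, (annihilate j : FockOp n) ∅ {i} = if j = i then 1 else 0 := by
    intro j
    have : ({i} : Finset (Fin n)) = {j} ↔ j = i := by rw [Finset.singleton_inj, eq_comm]
    simp [annihilate, create, fermiSign, this]
  have hs : fermiSign i (∅ : Finset (Fin n)) = 1 := by simp [fermiSign]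
  rw [add_mul, smul_mul_assoc, Matrix.add_apply, Matrix.smul_apply, create_mul_apply,
    create_mul_apply]
  simp only [Finset.mem_singleton, Matrix.smul_apply, Matrix.add_apply, smul_eq_mul]
  by_cases h1 : p = i
  · subst h1
    simp [hne, hann, hs]
  · by_cases h2 : q = i
    · subst h2
      simp [h1, hann, hs]
      simp only [Complex.star_def] at hx
      linear_combination γ.re * γ * hx
    · simp [h1, h2]

/-- Every site of `A` has a neighbour in `A`, where the two ends of the chain are neighbours. -/
def NoCyclicallyIsolatedSite {n : ℕ} (A : Finset (Fin n)) : Prop :=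
  ∀ p, finRotate n p ∈ A → p ∈ A ∨ finRotate n (finRotate n p) ∈ A

theorem exists_extensivelyLocal {n : ℕ} (hn : 1 < n) {γ : ℂ} (hγ : star γ * γ = 1)
    (hre : γ.re ≠ 0) {A : Finset (Fin n)} (hA : NoCyclicallyIsolatedSite A) :
    ∃ O : FockOp n, IsQuasiHermitian (totalMetric (farReducedMetric n γ)) O ∧
        IsExtensivelyLocal A O := by
  -- The cyclic bonds inside `A`, each indexed by its first site.
  set P := A.filter fun p => finRotate n p ∈ A with hP
  refine ⟨∑ p ∈ P, bondObs γ p, ?_, Submodule.sum_mem _ fun p hp => ?_, fun S hS hO => ?_⟩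
  · rw [IsQuasiHermitian, Matrix.conjTranspose_sum, Finset.mul_sum, Finset.sum_mul]
    exact Finset.sum_congr rfl fun p _ => isQuasiHermitian_bondObs hn hγ p
  · rw [hP, Finset.mem_filter] at hp
    exact bondObs_mem_bkLocal γ hp.1 hp.2
  · obtain ⟨i, hiA, hiS⟩ := Finset.exists_of_ssubset hS
    -- If `i` were not needed, `O` would commute with `a†ᵢ`, and the entry of this relation at
    -- `({i}, ∅)` equates the diagonal entries of `O` at `{i}` and at the vacuum.
    have h := congrFun (congrFun (commute_create_of_mem_bkLocal hiS hO) {i}) ∅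
    rw [mul_create_apply, create_mul_apply] at h
    have hs : fermiSign i (∅ : Finset (Fin n)) = 1 := by simp [fermiSign]
    simp only [Finset.notMem_empty, if_false, insert_empty_eq, Finset.mem_singleton, if_true,
      Finset.erase_singleton, hs, one_mul, Matrix.sum_apply, bondObs_vacuum,
      Finset.sum_const_zero, bondObs_singleton hn hγ, ← Finset.mul_sum] at h
    obtain ⟨r, rfl⟩ := (finRotate n).surjective i
    rw [Finset.sum_add_distrib] at h
    simp only [EmbeddingLike.apply_eq_iff_eq, Finset.sum_ite_eq', hP, Finset.mem_filter, hiA,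
      true_and, and_true] at h
    have h' := (mul_eq_zero.mp h).resolve_left (by exact_mod_cast hre)
    have hγ0 : γ ≠ 0 := fun h0 => by simp [h0] at hγ
    have h2 : star γ + γ = 2 * γ.re := by
      rw [star_eq_re_sub]; linear_combination re_add_I_mul_im γ
    -- Up to the factor `Re γ`, the entry at `{i}` is `γ*`, `γ` or `γ* + γ = 2 Re γ`, according to
    -- which neighbours of `i` lie in `A`. None of these vanishes.
    rcases hA r hiA with h1 | h1
    · rw [if_pos h1] at h'
      split_ifs at h'
      · rw [h2] at h'
        exact hre (by simpa using h')
      · exact hγ0 (by simpa using h')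
    · rw [if_pos h1] at h'
      split_ifs at h'
      · rw [h2] at h'
        exact hre (by simpa using h')
      · exact hγ0 (by simpa using h')

theorem noCyclicallyIsolatedSite_of_extensivelyLocal {n : ℕ} (hn : 1 < n) {γ : ℂ}
    (hγ : star γ * γ = 1) (hγ_im : γ.im ≠ 0) (hM : (farReducedMetric n γ).det ≠ 0)
    {A : Finset (Fin n)} {O : FockOp n}
    (hQ : IsQuasiHermitian (totalMetric (farReducedMetric n γ)) O) (hO : IsExtensivelyLocal A O) :
    NoCyclicallyIsolatedSite A := by
  intro p hi
  by_contra! h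
  obtain ⟨hc, ha⟩ := commute_of_neighbours_notMem hn hγ hγ_im hM hQ hO.1 h.1 h.2
  exact hO.2 _ (Finset.erase_ssubset hi) (mem_bkLocal_erase_of_commute hO.1 hc ha)

/-! ### From cyclic neighbours to components of the path graph -/

theorem SimpleGraph.exists_supp_ncard_eq_one_iff {V : Type*} (G : SimpleGraph V) :
    (∃ C : G.ConnectedComponent, C.supp.ncard = 1) ↔ ∃ v, ∀ w, ¬ G.Adj v w := by
  constructor
  · rintro ⟨C, hC⟩
    obtain ⟨v, hv⟩ := Set.ncard_eq_one.mp hC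
    refine ⟨v, fun w hw => ?_⟩
    have hvC : v ∈ C.supp := by rw [hv]; rfl
    have hwC : w ∈ C.supp := (C.mem_supp_congr_adj hw).mp hvC
    rw [hv, Set.mem_singleton_iff] at hwC
    exact hw.ne hwC.symm
  · rintro ⟨v, hv⟩
    refine ⟨G.connectedComponentMk v, Set.ncard_eq_one.mpr ⟨v, ?_⟩⟩
    ext w
    rw [SimpleGraph.ConnectedComponent.mem_supp_iff, SimpleGraph.ConnectedComponent.eq,
      Set.mem_singleton_iff]
    constructor
    · intro h
      obtain ⟨W⟩ := h.symm
      cases W with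
      | nil => rfl
      | cons h _ => exact absurd h (hv _)
    · rintro rfl; rfl

theorem noSingleSiteComponent_iff {n : ℕ} (A : Finset (Fin n)) :
    NoSingleSiteComponent A ↔ ∀ i ∈ A, ∃ j ∈ A, i.val + 1 = j.val ∨ j.val + 1 = i.val := by
  have h := (siteGraph A).exists_supp_ncard_eq_one_iff.not
  push Not at h
  rw [NoSingleSiteComponent, h]
  simp [siteGraph, SimpleGraph.pathGraph_adj]

/-- The ring has only one adjacency beyond those of the path, between the two ends. A site of `A`
that relies on it is an end, and then both ends lie in `A`. -/
theorem noCyclicallyIsolatedSite_iff {n : ℕ} (hn : 1 < n) (A : Finset (Fin n)) :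
    NoCyclicallyIsolatedSite A ↔ (NoSingleSiteComponent A ∨
      ∃ B : Finset (Fin n), A = chainEnds n ∪ B ∧ NoSingleSiteComponent B) := by
  have hcyc : NoCyclicallyIsolatedSite A ↔ ∀ i ∈ A, ∃ j ∈ A, (i.val + 1 = j.val ∨
      j.val + 1 = i.val) ∨ (i.val = 0 ∧ j.val + 1 = n) ∨ (j.val = 0 ∧ i.val + 1 = n) := by
    constructor
    · intro h i hi
      obtain ⟨p, rfl⟩ := (finRotate n).surjective i
      rcases h p hi with hp | hp
      · refine ⟨p, hp, ?_⟩
        have := finRotate_val p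
        split_ifs at this <;> omega
      · refine ⟨_, hp, ?_⟩
        have := finRotate_val (finRotate n p)
        split_ifs at this <;> omega
    · intro h p hi
      obtain ⟨j, hj, hij⟩ := h _ hi
      have h1 := finRotate_val p
      have h2 := finRotate_val (finRotate n p)
      have : j = p ∨ j = finRotate n (finRotate n p) := by
        simp only [Fin.ext_iff]
        have := j.isLt
        have := p.isLt
        split_ifs at h1 h2 <;> omega
      rcases this with rfl | rfl
      · exact Or.inl hj
      · exact Or.inr hj
  simp only [noSingleSiteComponent_iff, hcyc]
  constructor
  · intro h
    by_cases hA : ∀ i ∈ A, ∃ j ∈ A, i.val + 1 = j.val ∨ j.val + 1 = i.val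
    · exact Or.inl hA
    right
    push Not at hA
    obtain ⟨i, hi, hiso⟩ := hA
    obtain ⟨j, hj, hij⟩ := h i hi
    -- As `i` has no path neighbour in `A`, its cyclic neighbour `j` is reached through the closing
    -- bond, so `i` and `j` are the two ends.
    have hends : ∀ k : Fin n, k.val = 0 ∨ k.val + 1 = n → k ∈ A := by
      intro k hk
      have := hiso j hj
      have : k = i ∨ k = j := by
        simp only [Fin.ext_iff]
        omega
      rcases this with rfl | rfl <;> assumption
    -- `B` consists of the sites with a path neighbour in `A`. Such a neighbour lies in `B` too,
    -- because adjacency is symmetric.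
    refine ⟨A.filter fun i => ∃ j ∈ A, i.val + 1 = j.val ∨ j.val + 1 = i.val, ?_, ?_⟩
    · ext k
      simp only [chainEnds, Finset.mem_union, Finset.mem_filter, Finset.mem_univ, true_and]
      constructor
      · intro hk
        obtain ⟨l, hl, hkl⟩ := h k hk
        rcases hkl with hkl | hkl
        · exact Or.inr ⟨hk, l, hl, hkl⟩
        · exact Or.inl (by omega)
      · rintro (hk | hk)
        · exact hends k hk
        · exact hk.1
    · intro k hk
      obtain ⟨hk, l, hl, hkl⟩ := Finset.mem_filter.mp hk
      exact ⟨l, Finset.mem_filter.mpr ⟨hl, k, hk, hkl.symm⟩, hkl⟩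
  · rintro (h | ⟨B, rfl, h⟩) i hi
    · obtain ⟨j, hj, hij⟩ := h i hi
      exact ⟨j, hj, Or.inl hij⟩
    · have hend : ∀ k : Fin n, k.val = 0 ∨ k.val + 1 = n → k ∈ chainEnds n ∪ B := fun k hk =>
        Finset.mem_union_left _ (by simpa [chainEnds] using hk)
      rcases Finset.mem_union.mp hi with hi | hi
      · rw [chainEnds, Finset.mem_filter] at hi
        rcases hi.2 with h0 | h0
        · exact ⟨⟨n - 1, by omega⟩, hend _ (Or.inr (by simp; omega)), Or.inr (Or.inl ⟨h0, by simp; omega⟩)⟩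
        · exact ⟨⟨0, by omega⟩, hend _ (Or.inl rfl), Or.inr (Or.inr ⟨rfl, h0⟩)⟩
      · obtain ⟨j, hj, hij⟩ := h i hi
        exact ⟨j, Finset.mem_union_right _ hj, Or.inl hij⟩

theorem proposition6 (n : ℕ) (hn : 1 < n) (γ : ℂ) (hγ : star γ * γ = 1) (hγ_im : γ.im ≠ 0)
    (hM : (farReducedMetric n γ).det ≠ 0) (A : Finset (Fin n)) :
    (∃ O : FockOp n, IsQuasiHermitian (totalMetric (farReducedMetric n γ)) O ∧
        IsExtensivelyLocal A O) ↔
      (NoSingleSiteComponent A ∨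
        ∃ B : Finset (Fin n), A = chainEnds n ∪ B ∧ NoSingleSiteComponent B) := by
  rw [← noCyclicallyIsolatedSite_iff hn]
  constructor
  · rintro ⟨O, hQ, hO⟩
    exact noCyclicallyIsolatedSite_of_extensivelyLocal hn hγ hγ_im hM hQ hO
  · exact exists_extensivelyLocal hn hγ (re_ne_zero_of_det_ne_zero hn hγ hM)
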